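/- Let $K\subset\mathbb{R}$ be a real quadratic field with ring of integers $\mathcal{O}_K$ and norm $N=N_{K/\mathbb{Q}}$, let $\alpha\in\mathcal{O}_K^{\times}$ be a unit with $\alpha>0$ and $\alpha\neq\pm1$, and let $\Delta_n=N(\alpha^n-1)\in\mathbb{Z}$ for $n\geq 1$. A primitive prime divisor of $\Delta_n$ is a prime $p$ such that $p\mid\Delta_n$ and $p\nmid\Delta_m$ for every $1\leq m<n$ with $\Delta_m\neq 0$. (1) If $N(\alpha)=1$, then $\Delta_n$ has a primitive prime divisor for every $n>12$. (2) If $N(\alpha)=-1$, then for every $n>24$, $\Delta_n$ has no primitive prime divisor if and only if $n\equiv 2\pmod 4$. -/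

import Mathlib

open scoped NumberField

/-- For an integer sequence `(a n)` indexed by `n ≥ 1`, the prime `p` is a primitive prime divisor
of the term `a n`: it divides `a n`, and it divides no earlier nonzero term. -/
def IsPrimitivePrimeDivisor (a : ℕ → ℤ) (n p : ℕ) : Prop :=
  p.Prime ∧ (p : ℤ) ∣ a n ∧ ∀ m : ℕ, 1 ≤ m → m < n → a m ≠ 0 → ¬ (p : ℤ) ∣ a m

/-- The term `a n` has a primitive prime divisor. -/
def HasPrimitivePrimeDivisor (a : ℕ → ℤ) (n : ℕ) : Prop :=
  ∃ p : ℕ, IsPrimitivePrimeDivisor a n p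

/-- The Lehmer-Pierce sequence `Δ n = N(α ^ n - 1)` of an algebraic integer `α` of `K`.
The norm from `𝓞 K` to `ℤ` is the field norm of `K` over `ℚ`, as an integer. -/
noncomputable def lehmerPierce {K : Type*} [Field K] [NumberField K] (α : 𝓞 K) (n : ℕ) : ℤ :=
  Algebra.norm ℤ (α ^ n - 1)

theorem lehmerPierce_cast {K : Type*} [Field K] [NumberField K] (α : 𝓞 K) (n : ℕ) :
    (lehmerPierce α n : ℚ) = Algebra.norm ℚ ((α : K) ^ n - 1) := by
  simp [lehmerPierce, Algebra.coe_norm_int]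

open Polynomial

/-! For N(α) = 1, consider M = N(Φ_n(α)), which divides Δ_n. Modulo a maximal ideal above p, a prime
p ∣ M forces n = r p^k with r the order of α, and p is primitive if k = 0. If k > 0, then r ∣ p ± 1
leaves at most one such p for n > 12 (`eq_of_eq_mul_prime_pow`), and p³ ∤ M
(`not_pow_three_dvd_norm_geom_sum_of_dvd`). Without a primitive prime, |M| would thus be at most p².
But α has trace at least 3, so |M| > (13/5)^(φ(n) - 2) (`pow_lt_abs_norm_cyclotomic`), which is too
large unless n = 14 and p = 7, a case settled by an explicit formula.

For N(α) = -1, apply this to α², using Δ_{2m}(α) = Δ_m(α²). For odd m also Δ_{2m} = -Δ_m², so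
indices n ≡ 2 mod 4 gain no new prime; for all other n > 24 a primitive prime for α² transfers to α.
-/

/-! ### Reduction modulo a prime -/

theorem norm_natCast_eq_mul_self {R : Type*} [CommRing R] [CharZero R] {N : R →* ℤ} {τ : R →+* R}
    (hN : ∀ x, (N x : R) = x * τ x) (k : ℕ) : N (k : R) = (k : ℤ) * k := by
  have := hN (k : R)
  rw [map_natCast τ] at this
  exact_mod_cast this

theorem exists_isMaximal_charP_quotient {R : Type*} [CommRing R] [CharZero R] {N : R →* ℤ} {τ : R →+* R}
    (hN : ∀ x, (N x : R) = x * τ x) {p : ℕ} (hp : p.Prime) :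
    ∃ (I : Ideal R) (_ : I.IsMaximal), CharP (R ⧸ I) p := by
  have hne : Ideal.span {(p : R)} ≠ ⊤ := by
    rw [Ne, Ideal.span_singleton_eq_top]
    intro hu
    have h2 := hu.map N
    rw [norm_natCast_eq_mul_self hN] at h2
    have h3 : IsUnit (p : ℤ) := isUnit_of_mul_isUnit_left h2
    exact (Nat.prime_iff_prime_int.mp hp).not_isUnit h3
  obtain ⟨I, hI, hle⟩ := Ideal.exists_le_maximal _ hne
  refine ⟨I, hI, ?_⟩
  have h0 : ((p : ℕ) : R ⧸ I) = 0 := by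
    rw [← map_natCast (Ideal.Quotient.mk I)]
    exact Ideal.Quotient.eq_zero_iff_mem.mpr (hle (Ideal.mem_span_singleton_self _))
  have : Nontrivial (R ⧸ I) := Ideal.Quotient.nontrivial_iff.mpr hI.ne_top
  exact (CharP.charP_iff_prime_eq_zero hp).mpr h0

theorem map_intCast_norm {R S : Type*} [CommRing R] [CommRing S] {N : R →* ℤ} {τ : R →+* R}
    (hN : ∀ x, (N x : R) = x * τ x) (f : R →+* S) (x : R) :
    ((N x : ℤ) : S) = f x * f (τ x) := by
  rw [← map_mul, ← hN, map_intCast]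

theorem prime_dvd_norm_pow_sub_one_iff {R F : Type*} [CommRing R] [Field F]
    {N : R →* ℤ} {τ : R →+* R} (hN : ∀ x, (N x : R) = x * τ x) {a : R} (ha : a * τ a = 1)
    {p : ℕ} [CharP F p] (f : R →+* F) (n : ℕ) :
    (p : ℤ) ∣ N (a ^ n - 1) ↔ f a ^ n = 1 := by
  have h1 : f a * f (τ a) = 1 := by rw [← map_mul, ha, map_one]
  rw [← CharP.intCast_eq_zero_iff F p, map_intCast_norm hN f]
  simp only [map_sub, map_pow, map_one, mul_eq_zero, sub_eq_zero]
  refine ⟨fun h => h.elim id fun h => ?_, Or.inl⟩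
  simpa [mul_pow, h] using congrArg (· ^ n) h1

theorem exists_eq_orderOf_mul_pow_of_isRoot_cyclotomic {F : Type*} [Field F] {p n : ℕ}
    (hp : p.Prime) [CharP F p] (hn : 0 < n) {x : F} (hx : (cyclotomic n F).IsRoot x) :
    ∃ k, n = orderOf x * p ^ k := by
  have := Fact.mk hp
  obtain ⟨k, m, hm, rfl⟩ := Nat.exists_eq_pow_mul_and_not_dvd hn.ne' p hp.ne_one
  have : NeZero (m : F) := ⟨fun h => hm ((CharP.cast_eq_zero_iff F p m).mp h)⟩
  rw [isRoot_cyclotomic_prime_pow_mul_iff_of_charP] at hx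
  exact ⟨k, by rw [← hx.eq_orderOf, mul_comm]⟩

/-- Frobenius permutes the roots x, y = x⁻¹ of X² - tX + 1, so x^p is x or x⁻¹. -/
theorem orderOf_dvd_of_add_eq_intCast {F : Type*} [Field F] {p : ℕ} (hp : p.Prime) [CharP F p]
    {x y : F} (hxy : x * y = 1) {t : ℤ} (ht : x + y = t) :
    orderOf x ∣ p - 1 ∨ orderOf x ∣ p + 1 := by
  have := Fact.mk hp
  have h0 : x ≠ 0 := left_ne_zero_of_mul_eq_one hxy
  have h1 : x ^ p + y ^ p = x + y := by
    rw [← add_pow_char, ht]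
    exact map_intCast (frobenius F p) t
  have h2 : x ^ p * y ^ p = 1 := by rw [← mul_pow, hxy, one_pow]
  have h3 : (x ^ p - x) * (x ^ p - y) = 0 := by
    linear_combination (-x ^ p) * (- h1) - h2 + hxy
  rcases mul_eq_zero.mp h3 with h | h
  · left
    apply orderOf_dvd_of_pow_eq_one
    refine mul_right_cancel₀ h0 ?_
    rw [← pow_succ, Nat.sub_add_cancel hp.one_le, one_mul, sub_eq_zero.mp h]
  · right
    apply orderOf_dvd_of_pow_eq_one
    rw [pow_succ, sub_eq_zero.mp h, mul_comm, hxy]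

/-! ### Bounding the power of p in the norm -/

theorem cyclotomic_dvd_geom_sum {p d : ℕ} (hp : 1 < p) (hd : 0 < d) :
    cyclotomic (d * p) ℤ ∣ ∑ i ∈ Finset.range p, (X ^ d) ^ i := by
  have hlt : d < d * p := lt_mul_of_one_lt_right hd hp
  have h := X_pow_sub_one_mul_cyclotomic_dvd_X_pow_sub_one_of_dvd ℤ (d := d) (n := d * p)
    (Nat.mem_properDivisors.mpr ⟨dvd_mul_right _ _, hlt⟩)
  have h0 : (X ^ d - 1 : ℤ[X]) ≠ 0 := by
    rw [← C_1]
    exact X_pow_sub_C_ne_zero hd 1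
  have e : (X ^ (d * p) - 1 : ℤ[X]) = (X ^ d - 1) * ∑ i ∈ Finset.range p, (X ^ d) ^ i := by
    rw [mul_geom_sum, pow_mul]
  rw [e] at h
  exact (mul_dvd_mul_iff_left h0).mp h

/-- Expand in powers of g - 1: the constant term is p, the middle binomial coefficients are
divisible by p, and the hypothesis handles the top term. -/
theorem natCast_mul_sub_one_dvd_geom_sum_sub {R : Type*} [CommRing R] {p : ℕ} (hp : p.Prime)
    {g : R} (h : (p : R) * (g - 1) ∣ (g - 1) ^ (p - 1)) :
    (p : R) * (g - 1) ∣ ∑ i ∈ Finset.range p, g ^ i - p := by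
  have key : ∑ i ∈ Finset.range p, g ^ i
      = ∑ i ∈ Finset.range p, (p.choose (i + 1) : R) * (g - 1) ^ i := by
    have := congrArg (Polynomial.eval (g - 1)) (geom_sum_X_comp_X_add_one_eq_sum (R := R) p)
    simpa [eval_comp, eval_finsetSum] using this
  obtain ⟨q, rfl⟩ : ∃ q, p = q + 1 := ⟨p - 1, (Nat.sub_add_cancel hp.one_le).symm⟩
  rw [key, Finset.sum_range_succ']
  simp only [zero_add, Nat.choose_one_right, pow_zero, mul_one, add_sub_cancel_right]
  refine Finset.dvd_sum fun i hi => ?_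
  rw [Finset.mem_range] at hi
  rcases eq_or_lt_of_le (Nat.succ_le_of_lt hi) with h' | h'
  · have : i + 1 = q := h'
    simpa [this] using h
  · rw [pow_succ']
    refine mul_dvd_mul ?_ (dvd_mul_right _ _)
    exact Nat.cast_dvd_cast (hp.dvd_choose_self (by omega) (by omega))

/-- The sum is p times an element congruent to 1 in the residue field, so its norm is p² times an
integer prime to p. -/
theorem not_pow_three_dvd_norm_geom_sum {R F : Type*} [CommRing R] [CharZero R] [Field F]
    {N : R →* ℤ} {τ : R →+* R} (hN : ∀ x, (N x : R) = x * τ x) {g : R} (hg : g * τ g = 1)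
    {p : ℕ} (hp : p.Prime) [CharP F p] (f : R →+* F) (hfg : f g = 1)
    (h : (p : R) * (g - 1) ∣ (g - 1) ^ (p - 1)) :
    ¬ (p : ℤ) ^ 3 ∣ N (∑ i ∈ Finset.range p, g ^ i) := by
  obtain ⟨y, hy⟩ := natCast_mul_sub_one_dvd_geom_sum_sub hp h
  have hS : ∑ i ∈ Finset.range p, g ^ i = p * (1 + (g - 1) * y) := by
    linear_combination hy
  have hfg' : f (τ g) = 1 := by
    have := congrArg f hg
    rwa [map_mul, hfg, one_mul, map_one] at this
  rw [hS, map_mul, norm_natCast_eq_mul_self hN, pow_succ, pow_two]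
  intro hd
  have hp0 : (p : ℤ) * p ≠ 0 := by
    have := hp.ne_zero
    positivity
  have h1 := (CharP.intCast_eq_zero_iff F p _).mpr (Int.dvd_of_mul_dvd_mul_left hp0 hd)
  rw [map_intCast_norm hN f] at h1
  simp [hfg, hfg'] at h1

/-- This turns p ∣ N(g - 1) into p ∣ (g - 1)² in the ring itself, with no prime ideal factorization.
-/
theorem sub_one_sq_eq {R : Type*} [CommRing R] {N : R →* ℤ} {τ : R →+* R}
    (hN : ∀ x, (N x : R) = x * τ x) {g : R} (hg : g * τ g = 1) :
    (g - 1) ^ 2 = - g * N (g - 1) := by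
  rw [hN, map_sub, map_one]
  linear_combination (g - 1) * hg

/-- The norm of the quotient `(a ^ (d * p) - 1) / (a ^ d - 1)` is at most divisible by `p ^ 2`,
where `d = r * p ^ k` and `a ^ r = 1` in residue characteristic `p`. -/
theorem not_pow_three_dvd_norm_geom_sum_of_dvd {R F : Type*} [CommRing R] [CharZero R] [Field F]
    {N : R →* ℤ} {τ : R →+* R} (hN : ∀ x, (N x : R) = x * τ x) {a : R} (ha : a * τ a = 1)
    {p : ℕ} (hp : p.Prime) [CharP F p] (f : R →+* F) {r k : ℕ} (hr : f a ^ r = 1)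
    (h2 : p = 2 → 2 ≤ k) (h3 : p = 3 → 1 ≤ k) :
    ¬ (p : ℤ) ^ 3 ∣ N (∑ i ∈ Finset.range p, (a ^ (r * p ^ k)) ^ i) := by
  have hunit : ∀ m : ℕ, a ^ m * τ (a ^ m) = 1 := fun m => by
    rw [map_pow, ← mul_pow, ha, one_pow]
  have hsq : ∀ m : ℕ, (p : R) ∣ (a ^ (r * m) - 1) ^ 2 := fun m => by
    rw [sub_one_sq_eq hN (hunit _)]
    refine Dvd.dvd.mul_left ?_ _
    have : (p : ℤ) ∣ N (a ^ (r * m) - 1) := by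
      rw [prime_dvd_norm_pow_sub_one_iff hN ha f, pow_mul, hr, one_pow]
    obtain ⟨c, hc⟩ := this
    exact ⟨c, by rw [hc]; push_cast; rfl⟩
  have hf : f (a ^ (r * p ^ k)) = 1 := by rw [map_pow, pow_mul, hr, one_pow]
  rcases le_or_gt 4 p with h4 | h4
  · refine not_pow_three_dvd_norm_geom_sum hN (hunit _) hp f hf ?_
    obtain ⟨c, hc⟩ := hsq (p ^ k)
    have : p - 1 = (p - 4) + 1 + 2 := by omega
    rw [this, pow_add, pow_succ, hc]
    exact ⟨(a ^ (r * p ^ k) - 1) ^ (p - 4) * c, by ring⟩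
  obtain rfl | rfl : p = 2 ∨ p = 3 := by
    have := hp.two_le
    omega
  -- For p = 2 the sum is 1 + e⁴, of norm (s² - 2)² with s = e + τ e = 2 - 2c even, hence congruent
  -- to 4 mod 8.
  · obtain ⟨j, rfl⟩ : ∃ j, k = j + 2 := ⟨k - 2, by have := h2 rfl; omega⟩
    set e := a ^ (r * 2 ^ j) with he
    have he1 : e * τ e = 1 := hunit _
    have hpow : a ^ (r * 2 ^ (j + 2)) = e ^ 4 := by rw [he]; ring
    have hdvd : (2 : ℤ) ∣ N (e - 1) := by
      have := (prime_dvd_norm_pow_sub_one_iff (n := r * 2 ^ j) hN ha f).mpr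
        (by rw [pow_mul, hr, one_pow])
      exact_mod_cast this
    obtain ⟨c, hc⟩ := hdvd
    have hcR : (2 : R) * c = (e - 1) * τ (e - 1) := by rw [← hN, hc]; push_cast; rfl
    have hval : N (∑ i ∈ Finset.range 2, (a ^ (r * 2 ^ (j + 2))) ^ i)
        = ((2 - 2 * c) ^ 2 - 2) ^ 2 := by
      have : ((N (∑ i ∈ Finset.range 2, (a ^ (r * 2 ^ (j + 2))) ^ i) : ℤ) : R)
          = ((((2 - 2 * c) ^ 2 - 2) ^ 2 : ℤ) : R) := by
        have h22 : ((2 : R) - 2 * c) = e + τ e := by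
          rw [hcR, map_sub, map_one]
          linear_combination - he1
        push_cast
        rw [h22, hN, hpow]
        simp only [Finset.sum_range_succ, Finset.sum_range_zero, pow_zero, pow_one, zero_add,
          map_add, map_one, map_pow]
        have h4 : e ^ 4 * τ e ^ 4 = 1 := by rw [← mul_pow, he1, one_pow]
        have h5 : (e + τ e) ^ 2 - 2 = e ^ 2 + τ e ^ 2 := by linear_combination 2 * he1
        have h6 : e ^ 2 * τ e ^ 2 = 1 := by rw [← mul_pow, he1, one_pow]
        rw [h5]
        linear_combination h4 - 2 * h6
      exact_mod_cast this
    rw [hval]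
    rintro ⟨d, hd⟩
    have : ((2 - 2 * c) ^ 2 - 2) ^ 2 = 8 * (2 * ((1 - c) ^ 4 - (1 - c) ^ 2)) + 4 := by ring
    push_cast at hd
    omega
  -- For p = 3, writing g = e³ with 3 ∣ (e - 1)² gives 3 ∣ g - 1.
  · obtain ⟨j, rfl⟩ : ∃ j, k = j + 1 := ⟨k - 1, by have := h3 rfl; omega⟩
    refine not_pow_three_dvd_norm_geom_sum hN (hunit _) hp f hf ?_
    set e := a ^ (r * 3 ^ j) with he
    have hpow : a ^ (r * 3 ^ (j + 1)) = e ^ 3 := by rw [he]; ring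
    obtain ⟨c, hc⟩ := hsq (3 ^ j)
    rw [← he] at hc
    rw [hpow]
    have : e ^ 3 - 1 = 3 * ((e - 1) * (1 + (e - 1) + c)) := by
      push_cast at hc
      linear_combination (e - 1) * hc
    refine ⟨(e - 1) * (1 + (e - 1) + c), ?_⟩
    push_cast
    linear_combination (e ^ 3 - 1) * this

/-! ### Lower bound for cyclotomic values -/

theorem one_sub_sum_le_prod_one_sub {ι : Type*} (s : Finset ι) {u : ι → ℝ}
    (h0 : ∀ i ∈ s, 0 ≤ u i) (h1 : ∀ i ∈ s, u i ≤ 1) :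
    1 - ∑ i ∈ s, u i ≤ ∏ i ∈ s, (1 - u i) := by
  classical
  induction s using Finset.induction_on with
  | empty => simp
  | insert i s hi ih =>
    rw [Finset.sum_insert hi, Finset.prod_insert hi]
    have ih := ih (fun j hj => h0 j (Finset.mem_insert_of_mem hj))
      (fun j hj => h1 j (Finset.mem_insert_of_mem hj))
    have a0 := h0 i (Finset.mem_insert_self _ _)
    have a1 := h1 i (Finset.mem_insert_self _ _)
    have hs : 0 ≤ ∑ j ∈ s, u j :=
      Finset.sum_nonneg fun j hj => h0 j (Finset.mem_insert_of_mem hj)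
    nlinarith [mul_le_mul_of_nonneg_left ih (sub_nonneg.mpr a1), mul_nonneg a0 hs]

theorem self_le_zpow_moebius {g : ℝ} (h0 : 0 < g) (h1 : g ≤ 1) (n : ℕ) :
    g ≤ g ^ ArithmeticFunction.moebius n := by
  rcases ArithmeticFunction.moebius_eq_or n with h | h | h <;> rw [h]
  · simpa using h1
  · simp
  · rw [zpow_neg, zpow_one]
    exact h1.trans ((one_le_inv₀ h0).mpr h1)

/-- Möbius inversion writes F n as a product of powers of 1 - b^d with exponents in {-1, 0, 1};
taking every exponent to be 1 only lowers it, and a geometric series bounds the rest. F is abstract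
so as to cover both Φ_n(x) y^φ(n) and |Φ_n(y)|. -/
theorem lt_of_prod_divisors_eq_one_sub_pow {b : ℝ} (hb0 : 0 < b) (hb1 : b < 1) {F : ℕ → ℝ}
    (hF : ∀ n > 0, ∏ d ∈ n.divisors, F d = 1 - b ^ n) {n : ℕ} (hn : 0 < n) :
    1 - b / (1 - b) < F n := by
  have hg0 : ∀ m : ℕ, 0 < m → 0 < 1 - b ^ m := fun m hm =>
    sub_pos.mpr (pow_lt_one₀ hb0.le hb1 hm.ne')
  have hF0 : ∀ m : ℕ, 0 < m → F m ≠ 0 := fun m hm =>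
    Finset.prod_ne_zero_iff.mp (by rw [hF m hm]; exact (hg0 m hm).ne') m
      (Nat.mem_divisors_self m hm.ne')
  rw [← (ArithmeticFunction.prod_eq_iff_prod_pow_moebius_eq_of_nonzero hF0
    (fun m hm => (hg0 m hm).ne')).mp hF n hn]
  have h1 : ∏ d ∈ n.divisors, (1 - b ^ d) ≤ ∏ x ∈ n.divisorsAntidiagonal,
      (1 - b ^ x.2) ^ ArithmeticFunction.moebius x.1 := by
    rw [← Nat.prod_divisorsAntidiagonal' (f := fun _ j => 1 - b ^ j)]
    have hpos : ∀ x ∈ n.divisorsAntidiagonal, 0 < x.2 := fun x hx =>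
      Nat.pos_of_ne_zero (Nat.ne_zero_of_mem_divisorsAntidiagonal hx).2
    refine Finset.prod_le_prod (fun x hx => (hg0 _ (hpos x hx)).le) fun x hx => ?_
    exact self_le_zpow_moebius (hg0 _ (hpos x hx)) (by linarith [pow_pos hb0 x.2]) _
  have h2 := one_sub_sum_le_prod_one_sub n.divisors (u := fun d => b ^ d)
    (fun d _ => (pow_pos hb0 d).le) (fun d _ => pow_le_one₀ hb0.le hb1.le)
  have h3 : ∑ d ∈ n.divisors, b ^ d ≤ ∑ d ∈ Finset.range n, b ^ (d + 1) := by
    rw [Finset.range_eq_Ico, Finset.sum_Ico_add' (fun d => b ^ d) 0 n 1, zero_add]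
    exact Finset.sum_le_sum_of_subset_of_nonneg (Finset.filter_subset _ _)
      fun d _ _ => (pow_pos hb0 d).le
  have h4 : ∑ d ∈ Finset.range n, b ^ (d + 1) < b / (1 - b) := by
    have h5 : (∑ d ∈ Finset.range n, b ^ (d + 1)) * (1 - b) = b * (1 - b ^ n) := by
      rw [← mul_neg_geom_sum b n, Finset.sum_mul, Finset.mul_sum, Finset.mul_sum]
      exact Finset.sum_congr rfl fun i _ => by ring
    rw [lt_div_iff₀ (by linarith), h5]
    nlinarith [pow_pos hb0 n, mul_pos hb0 (pow_pos hb0 n)]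
  linarith

theorem prod_divisors_eval_cyclotomic (x : ℝ) {n : ℕ} (hn : 0 < n) :
    ∏ d ∈ n.divisors, (cyclotomic d ℝ).eval x = x ^ n - 1 := by
  simpa [eval_prod] using congrArg (eval x) (prod_cyclotomic_eq_X_pow_sub_one hn ℝ)

theorem pow_lt_abs_eval_cyclotomic_mul {x y : ℝ} (hx : 1 < x) (hxy : x * y = 1)
    (h3 : 3 ≤ x + y) {n m : ℕ} (hn : 0 < n) (hm : n.totient = m + 2) :
    (13 / 5 : ℝ) ^ m < |(cyclotomic n ℝ).eval x * (cyclotomic n ℝ).eval y| := by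
  have hy0 : 0 < y := pos_of_mul_pos_right (by rw [hxy]; exact one_pos) (by linarith)
  have hy1 : y < 1 := by nlinarith
  -- Equivalent to 3y ≤ 1 + y², which is x + y ≥ 3 multiplied by y.
  have hc : y ≤ 1 - y / (1 - y) := by
    rw [le_sub_iff_add_le, ← le_sub_iff_add_le', div_le_iff₀ (by linarith)]
    nlinarith [mul_le_mul_of_nonneg_left h3 hy0.le]
  have hA : y < (cyclotomic n ℝ).eval x * y ^ n.totient := by
    refine hc.trans_lt (lt_of_prod_divisors_eq_one_sub_pow hy0 hy1
      (F := fun d => (cyclotomic d ℝ).eval x * y ^ d.totient) (fun k hk => ?_) hn)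
    rw [Finset.prod_mul_distrib, prod_divisors_eval_cyclotomic x hk, Finset.prod_pow_eq_pow_sum,
      Nat.sum_totient, sub_mul, ← mul_pow, hxy, one_pow, one_mul]
  have hB : y < |(cyclotomic n ℝ).eval y| := by
    refine hc.trans_lt (lt_of_prod_divisors_eq_one_sub_pow hy0 hy1
      (F := fun d => |(cyclotomic d ℝ).eval y|) (fun k hk => ?_) hn)
    rw [← Finset.abs_prod, prod_divisors_eval_cyclotomic y hk, abs_sub_comm, abs_of_nonneg]
    exact sub_nonneg.mpr (pow_le_one₀ hy0.le hy1.le)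
  -- 13/5 lies just below (3 + √5)/2, the larger root of X² - 3X + 1.
  have hx' : 13 / 5 ≤ x := by
    by_contra! hlt
    nlinarith [mul_le_mul_of_nonneg_left h3 (by linarith : 0 ≤ x)]
  refine (pow_le_pow_left₀ (by norm_num) hx' m).trans_lt ?_
  rw [hm] at hA
  have hAB : y * y < (cyclotomic n ℝ).eval x * y ^ (m + 2) * |(cyclotomic n ℝ).eval y| :=
    mul_lt_mul'' hA hB hy0.le hy0.le
  rw [abs_mul, abs_of_pos (cyclotomic_pos' n hx)]
  have hk : 0 < x ^ (m + 2) := by positivity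
  have := mul_lt_mul_of_pos_left hAB hk
  have e1 : x ^ (m + 2) * (y * y) = x ^ m := by
    calc _ = x ^ m * (x * y) ^ 2 := by ring
      _ = _ := by rw [hxy]; ring
  have e2 : x ^ (m + 2) * ((cyclotomic n ℝ).eval x * y ^ (m + 2) * |(cyclotomic n ℝ).eval y|)
      = (cyclotomic n ℝ).eval x * |(cyclotomic n ℝ).eval y| := by
    calc _ = (x * y) ^ (m + 2) * ((cyclotomic n ℝ).eval x * |(cyclotomic n ℝ).eval y|) := by ring
      _ = _ := by rw [hxy]; ring
  rwa [e1, e2] at this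

/-! ### Arithmetic of the exceptional primes -/

theorem cyclotomic_fourteen : cyclotomic 14 ℤ = X ^ 6 - X ^ 5 + X ^ 4 - X ^ 3 + X ^ 2 - X + 1 := by
  have h7 : cyclotomic 7 ℤ = 1 + X + X ^ 2 + X ^ 3 + X ^ 4 + X ^ 5 + X ^ 6 := by
    have := Fact.mk (by norm_num : Nat.Prime 7)
    rw [cyclotomic_prime]
    simp [Finset.sum_range_succ]
  have h := cyclotomic_expand_eq_cyclotomic_mul (n := 7) Nat.prime_two (by norm_num) ℤ
  refine mul_right_cancel₀ (cyclotomic_ne_zero 7 ℤ) ?_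
  rw [show (14 : ℕ) = 7 * 2 from rfl, ← h, h7]
  simp only [map_add, map_one, map_pow, expand_X]
  ring

/-- If p < q, then q ∣ r ≤ p + 1 forces p = 2, q = 3, r = 3. Then 9 ∤ n, so n = 3s ≤ 12. -/
theorem eq_of_eq_mul_prime_pow {n p q r s k l : ℕ} (hn : 12 < n) (hp : p.Prime) (hq : q.Prime)
    (h1 : n = r * p ^ (k + 1)) (hr : r ∣ p - 1 ∨ r ∣ p + 1)
    (h2 : n = s * q ^ (l + 1)) (hs : s ∣ q - 1 ∨ s ∣ q + 1) : ¬ p < q := by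
  intro hpq
  have hqn : q ∣ r * p ^ (k + 1) := by rw [← h1, h2, pow_succ]; exact ⟨s * q ^ l, by ring⟩
  have hqr : q ∣ r := by
    rcases hq.dvd_mul.mp hqn with h | h
    · exact h
    · exact absurd ((Nat.prime_dvd_prime_iff_eq hq hp).mp (hq.dvd_of_dvd_pow h)) hpq.ne'
  have hp2 := hp.two_le
  have hqp : q = p + 1 := by
    rcases hr with h | h
    · have := Nat.le_of_dvd (by omega) (hqr.trans h)
      omega
    · have := Nat.le_of_dvd (by omega) (hqr.trans h)
      omega
  have hp2 : p = 2 := by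
    rcases hp.eq_two_or_odd with h | h
    · exact h
    · rcases hq.eq_two_or_odd with h' | h' <;> omega
  subst hp2
  subst hqp
  have hr3 : r = 3 := by
    rcases hr with h | h
    · have := Nat.le_of_dvd (by omega) (hqr.trans h); omega
    · exact Nat.dvd_antisymm h hqr
  subst hr3
  have hs4 : s ≤ 4 := by
    rcases hs with h | h
    · have := Nat.le_of_dvd (by omega) h; omega
    · exact Nat.le_of_dvd (by omega) h
  rcases l with _ | l
  · norm_num at h2; omega
  · have h3 : 3 ∣ 2 ^ (k + 1) := by
      refine ⟨s * 3 ^ l, ?_⟩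
      have : 3 * 2 ^ (k + 1) = 3 * (3 * (s * 3 ^ l)) := by
        rw [← h1, h2]; ring
      omega
    have := Nat.prime_three.dvd_of_dvd_pow h3
    omega

theorem sq_le_pow_of_five_le {m : ℕ} (hm : 5 ≤ m) : ((m : ℝ) + 3) ^ 2 ≤ (13 / 5 : ℝ) ^ m := by
  induction m, hm using Nat.le_induction with
  | base => norm_num
  | succ k hk ih =>
    have : (5 : ℝ) ≤ k := by exact_mod_cast hk
    rw [pow_succ (13 / 5 : ℝ)]
    push_cast
    nlinarith

/-- Apart from `n = 14`, the lower bound `(13 / 5) ^ (φ n - 2)` exceeds the possible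
contribution `p ^ 2` of a non-primitive prime. -/
theorem prime_sq_le_pow_totient {n m p r k : ℕ} (hn : 12 < n) (hp : p.Prime)
    (hm : n.totient = m + 2) (h1 : n = r * p ^ (k + 1)) (hr : r ∣ p - 1 ∨ r ∣ p + 1)
    (h14 : ¬ (n = 14 ∧ p = 7)) : (p : ℝ) ^ 2 ≤ (13 / 5 : ℝ) ^ m := by
  have hpos : 0 < m + 2 := by omega
  -- p - 1 divides φ(n) = m + 2; only m ≤ 4, hence p ≤ 7, then needs a case check.
  have hpm : p ≤ m + 3 := by
    have hd : p - 1 ∣ m + 2 := by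
      rw [← hm, ← Nat.totient_prime hp]
      exact Nat.totient_dvd_of_dvd ⟨r * p ^ k, by rw [h1]; ring⟩
    have := Nat.le_of_dvd hpos hd
    omega
  rcases le_or_gt 5 m with h5 | h5
  · refine le_trans ?_ (sq_le_pow_of_five_le h5)
    have : (p : ℝ) ≤ m + 3 := by exact_mod_cast hpm
    gcongr
  have hdvd : ∀ d, d ∣ n → d.totient ≤ m + 2 := fun d hd =>
    Nat.le_of_dvd hpos (hm ▸ Nat.totient_dvd_of_dvd hd)
  have mono : ∀ j, j ≤ m → (13 / 5 : ℝ) ^ j ≤ (13 / 5 : ℝ) ^ m := fun j hj =>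
    pow_le_pow_right₀ (by norm_num) hj
  have hsq : 1 ≤ k → (p ^ 2).totient ≤ m + 2 := fun hk =>
    hdvd _ ⟨r * p ^ (k - 1), by
      rw [h1, show k + 1 = 2 + (k - 1) by omega, pow_add]; ring⟩
  have hr' : ∀ j, p + 1 ≤ j → r ≤ j := fun j hj => by
    have := hp.two_le
    rcases hr with h | h
    · have := Nat.le_of_dvd (by omega) h; omega
    · have := Nat.le_of_dvd (by omega) h; omega
  have hp7 : p ≤ 7 := by omega
  interval_cases p
  · exact absurd hp (by norm_num)
  · exact absurd hp (by norm_num)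
  · have hk : 2 ≤ k := by
      by_contra! hlt
      have := hr' 3 le_rfl
      interval_cases k <;> omega
    have : Nat.totient (2 ^ 3) ≤ m + 2 := hdvd _ ⟨r * 2 ^ (k - 2), by
      rw [h1, show k + 1 = 3 + (k - 2) by omega, pow_add]; ring⟩
    rw [show Nat.totient (2 ^ 3) = 4 by decide] at this
    exact le_trans (by norm_num) (mono 2 (by omega))
  · have hk : 1 ≤ k := by
      by_contra! hlt
      have := hr' 4 le_rfl
      interval_cases k; omega
    have := hsq hk
    rw [show Nat.totient (3 ^ 2) = 6 by decide] at this
    exact le_trans (by norm_num) (mono 4 (by omega))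
  · exact absurd hp (by norm_num)
  · rcases Nat.eq_zero_or_pos k with rfl | hk
    · have h6 := hr' 6 le_rfl
      have hm4 : 4 ≤ m := by
        interval_cases r <;> subst h1 <;> simp at hn hr <;>
          (first | omega | (have : m + 2 = 8 := hm ▸ by decide); omega)
      exact le_trans (by norm_num) (mono 4 hm4)
    · have := hsq hk
      rw [show Nat.totient (5 ^ 2) = 20 by decide] at this
      omega
  · exact absurd hp (by norm_num)
  -- For p = 7 and n ≠ 14, φ(n) is at least 12, against m ≤ 4.
  · exfalso
    rcases Nat.eq_zero_or_pos k with rfl | hk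
    · have h6 := hr' 8 le_rfl
      interval_cases r <;> subst h1 <;> simp at hn hr h14 <;>
          (have : m + 2 = 12 ∨ m + 2 = 24 := hm ▸ by decide) <;> omega
    · have := hsq hk
      rw [show Nat.totient (7 ^ 2) = 42 by decide] at this
      omega

/-! ### Primitive divisors for elements of norm one -/

theorem map_aeval_cyclotomic {R S : Type*} [CommRing R] [CommRing S] (f : R →+* S) (a : R)
    (n : ℕ) : f (aeval a (cyclotomic n ℤ)) = (cyclotomic n S).eval (f a) := by
  rw [aeval_def, hom_eval₂, ← map_cyclotomic n (Int.castRingHom S), eval_map]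
  congr 1
  exact RingHom.ext_int _ _

theorem orderOf_eq_of_mul_eq_one {F : Type*} [Field F] {x y : F} (h : x * y = 1) :
    orderOf y = orderOf x := by
  have aux : ∀ u v : F, u * v = 1 → orderOf v ∣ orderOf u := fun u v huv => by
    apply orderOf_dvd_of_pow_eq_one
    simpa [mul_pow, pow_orderOf_eq_one] using congrArg (· ^ orderOf u) huv
  exact Nat.dvd_antisymm (aux x y h) (aux y x (by rw [mul_comm, h]))

section

variable {R : Type*} [CommRing R] {N : R →* ℤ} {τ : R →+* R}

theorem add_eq_norm_add_one_sub_two (hN : ∀ x, (N x : R) = x * τ x) {a : R} (ha : a * τ a = 1) :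
    a + τ a = ((N (a + 1) - 2 : ℤ) : R) := by
  push_cast
  rw [hN, map_add, map_one]
  linear_combination - ha

theorem pow_lt_abs_norm_cyclotomic (hN : ∀ x, (N x : R) = x * τ x) {a : R} (ha : a * τ a = 1)
    (σ : R →+* ℝ) (hpos : 0 < σ a) (hne : σ a ≠ 1) {n m : ℕ} (hn : 0 < n)
    (hm : n.totient = m + 2) :
    (13 / 5 : ℝ) ^ m < |(N (aeval a (cyclotomic n ℤ)) : ℝ)| := by
  have hxy : σ a * σ (τ a) = 1 := by rw [← map_mul, ha, map_one]
  have h3 : 3 ≤ σ a + σ (τ a) := by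
    have ht : σ a + σ (τ a) = ((N (a + 1) - 2 : ℤ) : ℝ) := by
      rw [← map_add, add_eq_norm_add_one_sub_two hN ha, map_intCast]
    have h2 : 2 < σ a + σ (τ a) := by
      have h1 : 0 < (σ a - 1) ^ 2 := by
        have := sub_ne_zero.mpr hne
        positivity
      have h4 : (σ a - 1) ^ 2 = σ a * (σ a + σ (τ a) - 2) := by linear_combination - hxy
      rw [h4] at h1
      linarith [pos_of_mul_pos_right h1 hpos.le]
    rw [ht] at h2 ⊢
    -- Integrality improves trace > 2 to trace ≥ 3.
    have : 2 < N (a + 1) - 2 := by exact_mod_cast h2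
    exact_mod_cast this
  rw [map_intCast_norm hN σ, map_aeval_cyclotomic, ← RingHom.comp_apply, map_aeval_cyclotomic,
    RingHom.comp_apply]
  rcases lt_or_gt_of_ne hne with h | h
  · rw [mul_comm]
    exact pow_lt_abs_eval_cyclotomic_mul (by nlinarith) (by rw [mul_comm, hxy])
      (by rwa [add_comm]) hn hm
  · exact pow_lt_abs_eval_cyclotomic_mul h hxy h3 hn hm

variable [CharZero R]

theorem eq_mul_pow_of_prime_dvd_norm_cyclotomic (hN : ∀ x, (N x : R) = x * τ x) {a : R} (ha : a * τ a = 1)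
    {n p : ℕ} (hn : 12 < n) (hp : p.Prime)
    (hnp : ¬ IsPrimitivePrimeDivisor (fun m => N (a ^ m - 1)) n p)
    (hd : (p : ℤ) ∣ N (aeval a (cyclotomic n ℤ))) :
    (∃ r k, n = r * p ^ (k + 1) ∧ (r ∣ p - 1 ∨ r ∣ p + 1)) ∧
      ¬ (p : ℤ) ^ 3 ∣ N (aeval a (cyclotomic n ℤ)) := by
  obtain ⟨I, hI, hchar⟩ := exists_isMaximal_charP_quotient hN hp
  let _ := Ideal.Quotient.field I
  set f := Ideal.Quotient.mk I
  have hab : f a * f (τ a) = 1 := by rw [← map_mul, ha, map_one]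
  obtain ⟨k, hk⟩ : ∃ k, n = orderOf (f a) * p ^ k := by
    have h := (CharP.intCast_eq_zero_iff (R ⧸ I) p _).mpr hd
    rw [map_intCast_norm hN f, mul_eq_zero] at h
    rcases h with h | h
    · rw [map_aeval_cyclotomic] at h
      exact exists_eq_orderOf_mul_pow_of_isRoot_cyclotomic hp (by omega) h
    · rw [← RingHom.comp_apply, map_aeval_cyclotomic] at h
      have := exists_eq_orderOf_mul_pow_of_isRoot_cyclotomic hp (by omega) h
      rwa [RingHom.comp_apply, orderOf_eq_of_mul_eq_one hab] at this
  have hr : f a ^ orderOf (f a) = 1 := pow_orderOf_eq_one _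
  have hrdvd : orderOf (f a) ∣ p - 1 ∨ orderOf (f a) ∣ p + 1 :=
    orderOf_dvd_of_add_eq_intCast hp hab (t := N (a + 1) - 2) (by
      rw [← map_add, add_eq_norm_add_one_sub_two hN ha, map_intCast])
  have hpn : (p : ℤ) ∣ N (a ^ n - 1) := by
    rw [prime_dvd_norm_pow_sub_one_iff hN ha f, hk, pow_mul, hr, one_pow]
  have hk0 : k ≠ 0 := by
    rintro rfl
    refine hnp ⟨hp, hpn, fun m hm hmn _ hdm => ?_⟩
    have := Nat.le_of_dvd hm (orderOf_dvd_of_pow_eq_one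
      ((prime_dvd_norm_pow_sub_one_iff hN ha f m).mp hdm))
    rw [pow_zero, mul_one] at hk
    omega
  obtain ⟨j, rfl⟩ := Nat.exists_eq_succ_of_ne_zero hk0
  generalize orderOf (f a) = r at hk hr hrdvd
  refine ⟨⟨r, j, hk, hrdvd⟩, fun h3 => ?_⟩
  have hr0 : 0 < r := Nat.pos_of_ne_zero fun h => by simp [h] at hk; omega
  refine not_pow_three_dvd_norm_geom_sum_of_dvd hN ha hp f hr (k := j) ?_ ?_ (h3.trans ?_)
  -- Since r ≤ 3, an exponent j ≤ 1 would give n ≤ 12; likewise below for p = 3, with r ≤ 4 and j =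
  -- 0.
  · rintro rfl
    by_contra! hlt
    have : r ≤ 3 := by
      rcases hrdvd with h | h
      · have := Nat.le_of_dvd (by omega) h; omega
      · exact Nat.le_of_dvd (by omega) h
    interval_cases j <;> omega
  · rintro rfl
    by_contra! hlt
    have : r ≤ 4 := by
      rcases hrdvd with h | h
      · have := Nat.le_of_dvd (by omega) h; omega
      · exact Nat.le_of_dvd (by omega) h
    interval_cases j; omega
  · have := cyclotomic_dvd_geom_sum (d := r * p ^ j) hp.one_lt
      (Nat.mul_pos hr0 (pow_pos hp.pos j))
    rw [show r * p ^ j * p = n by rw [hk, pow_succ]; ring] at this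
    have := map_dvd (aeval a) this
    simp only [map_sum, map_pow, aeval_X] at this
    exact map_dvd N this

/-- The general bound (13/5)⁴ falls short of 49. Instead Φ₁₄(a) = a³(t³ - t² - 2t + 1) with t = a +
τ a ≥ 3, and the cubic is at least 13. -/
theorem lt_abs_norm_cyclotomic_fourteen (hN : ∀ x, (N x : R) = x * τ x) {a : R}
    (ha : a * τ a = 1) (σ : R →+* ℝ) (hpos : 0 < σ a) (hne : σ a ≠ 1) :
    49 < |N (aeval a (cyclotomic 14 ℤ))| := by
  set t := N (a + 1) - 2 with ht
  have hat := add_eq_norm_add_one_sub_two hN ha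
  have hxy : σ a * σ (τ a) = 1 := by rw [← map_mul, ha, map_one]
  have h3 : 2 < t := by
    have ht : σ a + σ (τ a) = (t : ℝ) := by rw [← map_add, hat, map_intCast]
    have h1 : 0 < (σ a - 1) ^ 2 := by
      have := sub_ne_zero.mpr hne
      positivity
    have h4 : (σ a - 1) ^ 2 = σ a * (σ a + σ (τ a) - 2) := by linear_combination - hxy
    rw [h4] at h1
    have h2 := pos_of_mul_pos_right h1 hpos.le
    rw [ht] at h2
    exact_mod_cast sub_pos.mp h2
  have hval : N (aeval a (cyclotomic 14 ℤ)) = (t ^ 3 - t ^ 2 - 2 * t + 1) ^ 2 := by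
    have : ((N (aeval a (cyclotomic 14 ℤ)) : ℤ) : R)
        = (((t ^ 3 - t ^ 2 - 2 * t + 1) ^ 2 : ℤ) : R) := by
      rw [hN, cyclotomic_fourteen]
      push_cast
      rw [← hat]
      simp only [map_add, map_sub, map_pow, map_one, aeval_X]
      set b := τ a
      have e : ∀ u v : R, u * v = 1 → u ^ 6 - u ^ 5 + u ^ 4 - u ^ 3 + u ^ 2 - u + 1
          = u ^ 3 * ((u + v) ^ 3 - (u + v) ^ 2 - 2 * (u + v) + 1) := fun u v h => by
        have h2 : u ^ 2 * v ^ 2 = 1 := by rw [← mul_pow, h, one_pow]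
        have h3 : u ^ 3 * v ^ 3 = 1 := by rw [← mul_pow, h, one_pow]
        linear_combination (-3 * u ^ 4 + 2 * u ^ 3 + 2 * u ^ 2) * h + (u - 3 * u ^ 2) * h2 - h3
      have hab3 : a ^ 3 * b ^ 3 = 1 := by rw [← mul_pow, ha, one_pow]
      rw [e a b ha, e b a (by rw [mul_comm, ha]), add_comm b a]
      linear_combination ((a + b) ^ 3 - (a + b) ^ 2 - 2 * (a + b) + 1) ^ 2 * hab3
    exact_mod_cast this
  rw [hval, abs_of_nonneg (sq_nonneg _)]
  have h13 : 13 ≤ t ^ 3 - t ^ 2 - 2 * t + 1 := by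
    nlinarith [mul_nonneg (by omega : 0 ≤ t - 3) (sq_nonneg t), sq_nonneg (t - 3)]
  nlinarith

theorem hasPrimitivePrimeDivisor_of_mul_eq_one (hN : ∀ x, (N x : R) = x * τ x) {a : R}
    (ha : a * τ a = 1) (σ : R →+* ℝ) (hpos : 0 < σ a) (hne : σ a ≠ 1) {n : ℕ} (hn : 12 < n) :
    HasPrimitivePrimeDivisor (fun m => N (a ^ m - 1)) n := by
  by_contra hno
  set M := N (aeval a (cyclotomic n ℤ)) with hM
  have hbad : ∀ p : ℕ, p.Prime → (p : ℤ) ∣ M → _ := fun p hp hd =>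
    eq_mul_pow_of_prime_dvd_norm_cyclotomic hN ha hn hp (fun h => hno ⟨p, h⟩) hd
  obtain ⟨m, hm⟩ : ∃ m, n.totient = m + 2 := by
    have h1 := Nat.totient_pos.mpr (by omega : 0 < n)
    have h2 := Nat.totient_even (by omega : 2 < n)
    exact ⟨n.totient - 2, by obtain ⟨c, hc⟩ := h2; omega⟩
  have hlow := pow_lt_abs_norm_cyclotomic hN ha σ hpos hne (by omega : 0 < n) hm
  have hlow' : (13 / 5 : ℝ) ^ m < (M.natAbs : ℝ) := by
    rwa [Nat.cast_natAbs, Int.cast_abs]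
  have h1M : 1 < M.natAbs := by
    have : (1 : ℝ) < (M.natAbs : ℝ) := (one_le_pow₀ (by norm_num)).trans_lt hlow'
    exact_mod_cast this
  obtain ⟨p, hp, hpM⟩ := Nat.exists_prime_and_dvd h1M.ne'
  obtain ⟨⟨r, k, hnk, hr⟩, h3⟩ := hbad p hp (Int.natCast_dvd.mpr hpM)
  have huniq : ∀ {q : ℕ}, q.Prime → q ∣ M.natAbs → q = p := fun {q} hq hqM => by
    obtain ⟨⟨s, l, hnl, hs⟩, -⟩ := hbad q hq (Int.natCast_dvd.mpr hqM)
    have h1 := eq_of_eq_mul_prime_pow hn hp hq hnk hr hnl hs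
    have h2 := eq_of_eq_mul_prime_pow hn hq hp hnl hs hnk hr
    omega
  have hMp := Nat.eq_prime_pow_of_unique_prime_dvd (by omega : M.natAbs ≠ 0) huniq
  set j := M.natAbs.primeFactorsList.length
  have hj : j ≤ 2 := by
    by_contra! hlt
    apply h3
    have : p ^ 3 ∣ M.natAbs := hMp ▸ pow_dvd_pow p hlt
    exact_mod_cast Int.natCast_dvd.mpr this
  have hle : M.natAbs ≤ p ^ 2 := hMp.le.trans (Nat.pow_le_pow_right hp.pos hj)
  by_cases h14 : n = 14 ∧ p = 7
  · have := lt_abs_norm_cyclotomic_fourteen hN ha σ hpos hne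
    obtain ⟨rfl, rfl⟩ := h14
    rw [← hM, Int.abs_eq_natAbs] at this
    omega
  · have h4 := prime_sq_le_pow_totient hn hp hm hnk hr h14
    have : (M.natAbs : ℝ) ≤ (p : ℝ) ^ 2 := by exact_mod_cast hle
    linarith

theorem prime_dvd_norm_pow_gcd_sub_one (hN : ∀ x, (N x : R) = x * τ x) {a : R}
    (ha : a * τ a = 1) {p m n : ℕ} (hp : p.Prime) (hm : (p : ℤ) ∣ N (a ^ m - 1))
    (hn : (p : ℤ) ∣ N (a ^ n - 1)) : (p : ℤ) ∣ N (a ^ m.gcd n - 1) := by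
  obtain ⟨I, hI, hchar⟩ := exists_isMaximal_charP_quotient hN hp
  let _ := Ideal.Quotient.field I
  set f := Ideal.Quotient.mk I
  rw [prime_dvd_norm_pow_sub_one_iff hN ha f] at *
  exact pow_gcd_eq_one.mpr ⟨hm, hn⟩

end

/-! ### Real quadratic fields and units of norm -1 -/

theorem exists_conj_of_finrank_eq_two {K : Type*} [Field K] [NumberField K]
    (hK : Module.finrank ℚ K = 2) :
    ∃ τ : 𝓞 K →+* 𝓞 K, ∀ x, ((Algebra.norm ℤ x : ℤ) : 𝓞 K) = x * τ x := by
  classical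
  have : Algebra.IsQuadraticExtension ℚ K := ⟨hK⟩
  have hc : Fintype.card (K ≃ₐ[ℚ] K) = 2 := by
    rw [← Nat.card_eq_fintype_card, IsGalois.card_aut_eq_finrank, hK]
  obtain ⟨s, hs⟩ := Fintype.exists_ne_of_one_lt_card (by omega) (1 : K ≃ₐ[ℚ] K)
  have huniv : (Finset.univ : Finset (K ≃ₐ[ℚ] K)) = {1, s} :=
    (Finset.eq_of_subset_of_card_le (Finset.subset_univ _)
      (by rw [Finset.card_univ, hc, Finset.card_pair hs.symm])).symm
  refine ⟨NumberField.RingOfIntegers.mapRingHom (s : K →+* K), fun x => ?_⟩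
  apply NumberField.RingOfIntegers.ext
  have h := Algebra.norm_eq_prod_automorphisms ℚ (x : K)
  rw [huniv, Finset.prod_pair hs.symm, ← Algebra.coe_norm_int] at h
  simpa using h

theorem lehmerPierce_two_mul {K : Type*} [Field K] [NumberField K] (α : 𝓞 K) (m : ℕ) :
    lehmerPierce α (2 * m) = lehmerPierce (α ^ 2) m := by
  simp only [lehmerPierce, pow_mul]

theorem lehmerPierce_dvd_two_mul {K : Type*} [Field K] [NumberField K] (α : 𝓞 K) (m : ℕ) :
    lehmerPierce α m ∣ lehmerPierce α (2 * m) :=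
  map_dvd (Algebra.norm ℤ) ⟨α ^ m + 1, by ring⟩

theorem lehmerPierce_two_mul_of_odd {K : Type*} [Field K] [NumberField K]
    {τ : 𝓞 K →+* 𝓞 K} (hτ : ∀ x, ((Algebra.norm ℤ x : ℤ) : 𝓞 K) = x * τ x) {α : 𝓞 K}
    (hα : α * τ α = -1) {m : ℕ} (hm : Odd m) :
    lehmerPierce α (2 * m) = - lehmerPierce α m ^ 2 := by
  have h1 : α ^ m * τ α ^ m = -1 := by rw [← mul_pow, hα, hm.neg_one_pow]
  have : ((lehmerPierce α (2 * m) : ℤ) : 𝓞 K) = ((- lehmerPierce α m ^ 2 : ℤ) : 𝓞 K) := by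
    push_cast
    rw [lehmerPierce, lehmerPierce, hτ, hτ, mul_comm 2 m, pow_mul]
    simp only [map_sub, map_pow, map_one]
    linear_combination 2 * (α ^ m - 1) * (τ α ^ m - 1) * h1
  exact_mod_cast this

theorem hasPrimitivePrimeDivisor_of_norm_eq_one {K : Type*} [Field K] [NumberField K]
    {τ : 𝓞 K →+* 𝓞 K} (hτ : ∀ x, ((Algebra.norm ℤ x : ℤ) : 𝓞 K) = x * τ x)
    (σ : K →+* ℝ) {α : 𝓞 K} (hα : α * τ α = 1) (hpos : 0 < σ (α : K)) (hne : α ≠ 1) {n : ℕ}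
    (hn : 12 < n) : HasPrimitivePrimeDivisor (lehmerPierce α) n := by
  refine hasPrimitivePrimeDivisor_of_mul_eq_one hτ hα (σ.comp (algebraMap (𝓞 K) K)) hpos ?_ hn
  intro h
  apply hne
  apply NumberField.RingOfIntegers.ext
  apply σ.injective
  simpa using h

/-- `K` is a real quadratic field, viewed in `ℝ` through the embedding `σ`. -/
theorem theorem1p4 {K : Type*} [Field K] [NumberField K] (hK : Module.finrank ℚ K = 2)
    (σ : K →+* ℝ) (α : (𝓞 K)ˣ) (hα_one : α ≠ 1) (hα_neg_one : α ≠ -1)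
    (hα_pos : 0 < σ ((α : 𝓞 K) : K)) :
    (Algebra.norm ℚ ((α : 𝓞 K) : K) = 1 →
      ∀ n : ℕ, 12 < n → HasPrimitivePrimeDivisor (lehmerPierce (α : 𝓞 K)) n) ∧
    (Algebra.norm ℚ ((α : 𝓞 K) : K) = -1 →
      ∀ n : ℕ, 24 < n →
        (¬ HasPrimitivePrimeDivisor (lehmerPierce (α : 𝓞 K)) n ↔ n ≡ 2 [MOD 4])) := by
  obtain ⟨τ, hτ⟩ := exists_conj_of_finrank_eq_two hK
  have hα1 : (α : 𝓞 K) ≠ 1 := fun h => hα_one (Units.ext h)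
  have hαn1 : (α : 𝓞 K) ≠ -1 := fun h => hα_neg_one (Units.ext (by simpa using h))
  generalize (α : 𝓞 K) = a at hα1 hαn1 hα_pos ⊢
  rw [← Algebra.coe_norm_int]
  refine ⟨fun hN n hn => ?_, fun hN n hn => ?_⟩
  · have ha : a * τ a = 1 := by
      rw [← hτ, show Algebra.norm ℤ a = 1 by exact_mod_cast hN, Int.cast_one]
    exact hasPrimitivePrimeDivisor_of_norm_eq_one hτ σ ha hα_pos hα1 hn
  have ha : a * τ a = -1 := by
    rw [← hτ, show Algebra.norm ℤ a = -1 by exact_mod_cast hN, Int.cast_neg, Int.cast_one]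
  have ha2 : a ^ 2 * τ (a ^ 2) = 1 := by
    rw [map_pow, ← mul_pow, ha]
    ring
  have hsq1 : a ^ 2 ≠ 1 := fun h =>
    (mul_self_eq_one_iff.mp (by rwa [← sq])).elim hα1 hαn1
  have hprim : ∀ m : ℕ, 12 < m → HasPrimitivePrimeDivisor (lehmerPierce (a ^ 2)) m := fun m hm =>
    hasPrimitivePrimeDivisor_of_norm_eq_one hτ σ ha2 (by simpa using pow_pos hα_pos 2) hsq1 hm
  have hne2 : ∀ m, 1 ≤ m → lehmerPierce (a ^ 2) m ≠ 0 := fun m hm h => by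
    rw [lehmerPierce, Algebra.norm_eq_zero_iff, sub_eq_zero, ← pow_mul] at h
    have h' : σ (a : K) ^ (2 * m) = 1 := by
      have := congrArg (fun x : 𝓞 K => σ (x : K)) h
      simpa using this
    have h1 := (pow_eq_one_iff_of_nonneg hα_pos.le (by omega)).mp h'
    apply hα1
    apply NumberField.RingOfIntegers.ext
    apply σ.injective
    simpa using h1
  constructor
  · intro hno
    by_contra hmod
    apply hno
    rcases Nat.even_or_odd n with ⟨c, hc⟩ | hodd
    · have hc2 : Even c := by
        by_contra hodd
        rw [Nat.not_even_iff_odd] at hodd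
        obtain ⟨d, hd⟩ := hodd
        apply hmod
        rw [Nat.ModEq]
        omega
      obtain ⟨p, hp, hpn, hpm⟩ := hprim c (by omega)
      refine ⟨p, hp, by rwa [hc, ← two_mul, lehmerPierce_two_mul], fun m hm hmn _ hdm => ?_⟩
      rcases Nat.even_or_odd m with ⟨d, hd⟩ | hmodd
      · rw [hd, ← two_mul, lehmerPierce_two_mul] at hdm
        exact hpm d (by omega) (by omega) (hne2 d (by omega)) hdm
      -- For odd m, p would also divide the term of α² at gcd(m, c), a proper divisor of c because c
      -- is even.
      · have h1 : (p : ℤ) ∣ lehmerPierce (a ^ 2) m := by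
          rw [← lehmerPierce_two_mul]
          exact hdm.trans (lehmerPierce_dvd_two_mul a m)
        have hgpos : 0 < m.gcd c := Nat.gcd_pos_of_pos_left _ hm
        have hlt : m.gcd c < c := by
          refine lt_of_le_of_ne (Nat.le_of_dvd (by omega) (Nat.gcd_dvd_right m c)) fun heq => ?_
          have hcm : c ∣ m := heq ▸ Nat.gcd_dvd_left m c
          exact Nat.not_even_iff_odd.mpr hmodd (hc2.trans_dvd hcm)
        exact hpm _ hgpos hlt (hne2 _ hgpos) (prime_dvd_norm_pow_gcd_sub_one hτ ha2 hp h1 hpn)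
    · obtain ⟨p, hp, hpn, hpm⟩ := hprim n (by omega)
      refine ⟨p, hp, ?_, fun m hm hmn _ hdm => ?_⟩
      · rw [← lehmerPierce_two_mul, lehmerPierce_two_mul_of_odd hτ ha hodd, dvd_neg] at hpn
        exact (Nat.prime_iff_prime_int.mp hp).dvd_of_dvd_pow hpn
      · apply hpm m hm hmn (hne2 m hm)
        rw [← lehmerPierce_two_mul]
        exact hdm.trans (lehmerPierce_dvd_two_mul a m)
  -- With n = 2c and c odd, Δ_n = -Δ_c², so every prime of Δ_n already divides the nonzero Δ_c.
  · rintro hmod ⟨p, hp, hpn, hpm⟩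
    rw [Nat.ModEq] at hmod
    obtain ⟨c, rfl⟩ : ∃ c, n = 2 * c := ⟨n / 2, by omega⟩
    have hodd : Odd c := Nat.odd_iff.mpr (by omega)
    refine hpm c (by omega) (by omega) (fun h => hne2 c (by omega) ?_) ?_
    · rw [← lehmerPierce_two_mul, lehmerPierce_two_mul_of_odd hτ ha hodd, h]
      rfl
    · rw [lehmerPierce_two_mul_of_odd hτ ha hodd, dvd_neg] at hpn
      exact (Nat.prime_iff_prime_int.mp hp).dvd_of_dvd_pow hpn
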